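/- Let $n\ge 2$. Identify $\mathbb R^{2n}$ with $\mathbb C^n$ with its Euclidean norm $|\cdot|$. For $\xi\in\mathbb C^n$ with $|\xi|=1$ let $H_\xi=\{z\in\mathbb C^n:\sum_{k=1}^n z_k\overline{\xi_k}=0\}$. A convex body (compact convex set) $K\subset\mathbb R^{2n}$ with the origin in its interior and with Minkowski functional $\|\cdot\|_K$ is called $R_\theta$-invariant if $\|e^{i\theta}z\|_K=\|z\|_K$ for all $z\in\mathbb C^n$ and all $\theta\in[0,2\pi]$. In the ball model of the complex hyperbolic space $\mathbb H^n_{\mathbb C}$, for a convex body $K$ contained in the open unit ball, put $$\mathrm{HVol}_{2n}(K)=8^n\int_K\frac{dx}{(1-|x|^2)^{n+1}},\qquad \mathrm{HVol}_{2n-2}(K\cap H_\xi)=8^{n-1}\int_{K\cap H_\xi}\frac{dx}{(1-|x|^2)^{n}},$$ where $dx$ is Lebesgue measure on $\mathbb R^{2n}$ and on the $(2n-2)$-dimensional real subspace $H_\xi$, respectively. (a) If $n=2$, then for all $R_\theta$-invariant convex bodies $K,L$ in $\mathbb R^{2n}$ that have the origin in their interior and are contained in the open unit ball, if $\mathrm{HVol}_{2n-2}(K\cap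 H_\xi)\le \mathrm{HVol}_{2n-2}(L\cap H_\xi)$ for every $\xi\in\mathbb C^n$ with $|\xi|=1$, then $\mathrm{HVol}_{2n}(K)\le \mathrm{HVol}_{2n}(L)$. (b) For every $n\ge 3$ there exist $R_\theta$-invariant convex bodies $K,L$ in $\mathbb R^{2n}$, having the origin in their interior and contained in the open unit ball, such that $\mathrm{HVol}_{2n-2}(K\cap H_\xi)\le \mathrm{HVol}_{2n-2}(L\cap H_\xi)$ for every $\xi\in\mathbb C^n$ with $|\xi|=1$, but $\mathrm{HVol}_{2n}(K)>\mathrm{HVol}_{2n}(L)$. -/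

import Mathlib

open MeasureTheory Metric

noncomputable section

/-- The volume of the ball model of complex hyperbolic `m`-space, on a real inner product space `E`
of dimension `2 * m`: the measure on the open unit ball of `E` with density
`8 ^ m / (1 - |x| ^ 2) ^ (m + 1)` with respect to Lebesgue measure; in polar coordinates,
`8 ^ m * r ^ (2 * m - 1) / (1 - r ^ 2) ^ (m + 1) dr dσ`. -/
def complexHyperbolicVolume (m : ℕ) (E : Type*) [NormedAddCommGroup E] [InnerProductSpace ℝ E]
    [FiniteDimensional ℝ E] [MeasurableSpace E] [BorelSpace E] : Measure E :=
  ((volume : Measure E).restrict (ball 0 1)).withDensity fun x =>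
    ENNReal.ofReal (8 ^ m / (1 - ‖x‖ ^ 2) ^ (m + 1))

/-- The complex hyperplane `H_ξ = {z | ∑ z_k * conj ξ_k = 0}` through the origin, as a real
subspace; for `ξ ≠ 0` it has real dimension `2 * (n - 1)`. -/
def complexHyperplane {n : ℕ} (ξ : EuclideanSpace ℂ (Fin n)) :
    Submodule ℝ (EuclideanSpace ℂ (Fin n)) :=
  ((Submodule.span ℂ {ξ})ᗮ).restrictScalars ℝ

/-- `HVol_{2n}(A)`, with `ℝ^{2n}` identified with `ℂ^n`. -/
def HVol {n : ℕ} (A : Set (EuclideanSpace ℂ (Fin n))) : ENNReal :=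
  complexHyperbolicVolume n (EuclideanSpace ℂ (Fin n)) A

/-- `HVol_{2n-2}(A ∩ H_ξ)` for `ξ ≠ 0` (hence `n ≥ 1`): the volume of the section in the ball model
of complex hyperbolic `(n-1)`-space carried by the unit ball of `H_ξ`. -/
def sectionHVol {n : ℕ} (A : Set (EuclideanSpace ℂ (Fin n))) (ξ : EuclideanSpace ℂ (Fin n)) :
    ENNReal :=
  complexHyperbolicVolume (n - 1) (complexHyperplane ξ)
    {x | (x : EuclideanSpace ℂ (Fin n)) ∈ A}

/-- The convex body `K` (compact, convex) has the origin in its interior, its Minkowski functional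
is invariant under simultaneous rotation of all complex coordinates by any angle, and it is
contained in the open unit ball. -/
structure IsInvariantBodyInBall {n : ℕ} (K : ConvexBody (EuclideanSpace ℂ (Fin n))) : Prop where
  zero_mem_interior : 0 ∈ interior (K : Set (EuclideanSpace ℂ (Fin n)))
  rotation_invariant : ∀ θ ∈ Set.Icc (0 : ℝ) (2 * Real.pi), ∀ ξ : EuclideanSpace ℂ (Fin n),
    gauge (K : Set (EuclideanSpace ℂ (Fin n))) (Complex.exp (θ * Complex.I) • ξ) =
      gauge (K : Set (EuclideanSpace ℂ (Fin n))) ξ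
  subset_ball : (K : Set (EuclideanSpace ℂ (Fin n))) ⊆ ball 0 1

end

/-!
For `n = 2` the hyperplanes `H_ξ` are the complex lines, and an `R_θ`-invariant convex body meets a
complex line in a disc. Comparing the volumes of two such discs compares their radii, so the
hypothesis forces `K ⊆ L`.

For `n = m + 1 ≥ 3` consider the bodies `{x | ‖x‖² (1 + ε / w(|ℓ x|² / ‖x‖²)) ≤ 1}`, where `ℓ` is
the first coordinate and `w > 0` is smooth. For small `ε` they are `C²`-close to the unit ball,
hence convex. Since `(r² / (1 - r²)) ^ k` is, up to a constant, a primitive of the radial volume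
density in real dimension `2k`, the volume of such a body, or of its section, is a multiple of the
integral of `w(|ℓ θ|²) ^ k` over the unit sphere. Now put `y = m |ℓ θ|² - 1` and choose the two
weights with `w_K ^ m = w_L ^ m + y`. On the unit sphere of a hyperplane the mean of `|ℓ θ|²` is
at most `1 / m`, so the sections of `K` are no larger than those of `L`. On the other hand,
the Bernoulli inequality gives `m (w_K ^ (m + 1) - w_L ^ (m + 1)) ≥ (m + 1) w_L y`, so `K` has the
larger volume as soon as `∫ w_L y > 0`, and this is achieved by making `w_L` large where `y > 0`.
-/

section Sphere

open Set Module
open scoped Pointwise RealInnerProductSpace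

/-- The surface measure on the unit sphere of a Euclidean space. -/
noncomputable abbrev sphereMeasure (E : Type*) [NormedAddCommGroup E] [InnerProductSpace ℝ E]
    [FiniteDimensional ℝ E] [MeasurableSpace E] [BorelSpace E] : Measure (sphere (0 : E) 1) :=
  (volume : Measure E).toSphere

lemma integrable_of_continuous_of_compactSpace {X : Type*} [TopologicalSpace X] [CompactSpace X]
    [MeasurableSpace X] [OpensMeasurableSpace X] {μ : Measure X} [IsFiniteMeasureOnCompacts μ]
    {f : X → ℝ} (hf : Continuous f) : Integrable f μ :=
  hf.integrable_of_hasCompactSupport (.of_compactSpace f)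

section PolarCoordinates

variable {E : Type*} [NormedAddCommGroup E] [NormedSpace ℝ E] [FiniteDimensional ℝ E]
  [MeasurableSpace E] [BorelSpace E] [Nontrivial E] (μ : Measure E) [μ.IsAddHaarMeasure]

lemma lintegral_eq_lintegral_toSphere {f : E → ENNReal} (hf : Measurable f) :
    ∫⁻ x, f x ∂μ = ∫⁻ θ, (∫⁻ r in Ioi (0 : ℝ),
      ENNReal.ofReal (r ^ (finrank ℝ E - 1)) * f (r • (θ : E))) ∂μ.toSphere := by
  have hpolar : Measurable fun q : sphere (0 : E) 1 × Ioi (0 : ℝ) ↦ f ((q.2 : ℝ) • (q.1 : E)) := by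
    fun_prop
  calc
    ∫⁻ x, f x ∂μ = ∫⁻ x : ({(0)}ᶜ : Set E), f x ∂(μ.comap (↑)) := by
      rw [lintegral_subtype_comap (measurableSet_singleton _).compl f, restrict_compl_singleton]
    _ = ∫⁻ q, f ((q.2 : ℝ) • (q.1 : E)) ∂μ.toSphere.prod
          (.volumeIoiPow (finrank ℝ E - 1)) := by
      rw [← μ.measurePreserving_homeomorphUnitSphereProd.lintegral_comp hpolar]
      refine lintegral_congr fun x ↦ ?_
      have hx : ‖(x : E)‖ ≠ 0 := norm_ne_zero_iff.2 x.2
      simp [hx]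
    _ = _ := by
      rw [lintegral_prod _ hpolar.aemeasurable]
      refine lintegral_congr fun θ ↦ ?_
      rw [Measure.volumeIoiPow, lintegral_withDensity_eq_lintegral_mul _ (by fun_prop)
        (by fun_prop), ← lintegral_subtype_comap measurableSet_Ioi]
      rfl

lemma setLIntegral_eq_lintegral_toSphere {A : Set E} (hA : MeasurableSet A) {f : E → ENNReal}
    (hf : Measurable f) :
    ∫⁻ x in A, f x ∂μ = ∫⁻ θ : sphere (0 : E) 1, (∫⁻ r in {r : ℝ | r • (θ : E) ∈ A} ∩ Ioi 0,
      ENNReal.ofReal (r ^ (finrank ℝ E - 1)) * f (r • (θ : E))) ∂μ.toSphere := by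
  rw [← lintegral_indicator hA, lintegral_eq_lintegral_toSphere μ (hf.indicator hA)]
  refine lintegral_congr fun θ ↦ ?_
  have hray : MeasurableSet {r : ℝ | r • (θ : E) ∈ A} :=
    hA.preimage (f := fun r : ℝ ↦ r • (θ : E)) (by fun_prop)
  rw [← Measure.restrict_restrict hray, ← lintegral_indicator hray]
  refine lintegral_congr fun r ↦ ?_
  by_cases hr : r • (θ : E) ∈ A <;> simp [hr]

end PolarCoordinates

variable {E F : Type*} [NormedAddCommGroup E] [InnerProductSpace ℝ E] [FiniteDimensional ℝ E]
  [MeasurableSpace E] [BorelSpace E] [NormedAddCommGroup F] [InnerProductSpace ℝ F]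
  [FiniteDimensional ℝ F]

lemma integral_sphere_comp_linearIsometryEquiv (f : E → ℝ) (e : E ≃ₗᵢ[ℝ] E) :
    ∫ θ : sphere (0 : E) 1, f (e θ) ∂sphereMeasure E =
      ∫ θ : sphere (0 : E) 1, f θ ∂sphereMeasure E := by
  have hsphere (x : E) : x ∈ sphere (0 : E) 1 ↔ e x ∈ sphere (0 : E) 1 := by simp
  let T : sphere (0 : E) 1 ≃ₜ sphere (0 : E) 1 := e.toHomeomorph.subtype hsphere
  have hcone (s : Set (sphere (0 : E) 1)) :
      Ioo (0 : ℝ) 1 • ((↑) '' (T ⁻¹' s) : Set E) = e ⁻¹' (Ioo (0 : ℝ) 1 • ((↑) '' s)) := by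
    ext x
    simp only [mem_smul, mem_preimage]
    constructor
    · rintro ⟨r, hr, _, ⟨θ, hθ, rfl⟩, rfl⟩
      exact ⟨r, hr, T θ, ⟨T θ, hθ, rfl⟩, (map_smul e r (θ : E)).symm⟩
    · rintro ⟨r, hr, _, ⟨θ, hθ, rfl⟩, hx⟩
      refine ⟨r, hr, T.symm θ, ⟨T.symm θ, by simpa using hθ, rfl⟩, e.injective ?_⟩
      rw [map_smul, ← hx]
      exact congrArg (fun θ : sphere (0 : E) 1 ↦ r • (θ : E)) (T.apply_symm_apply θ)
  have hT : MeasurePreserving T (sphereMeasure E) (sphereMeasure E) := by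
    refine ⟨T.measurable, Measure.ext fun s hs ↦ ?_⟩
    rw [Measure.map_apply T.measurable hs, Measure.toSphere_apply' _ (T.measurable hs),
      Measure.toSphere_apply' _ hs, hcone s]
    exact congrArg _ (e.measurePreserving.measure_preimage_equiv (f := e.toMeasurableEquiv) _)
  exact hT.integral_comp T.measurableEmbedding fun θ ↦ f θ

lemma finrank_mul_integral_sphere_inner_sq (u : E) :
    finrank ℝ E * ∫ θ : sphere (0 : E) 1, ⟪u, (θ : E)⟫ ^ 2 ∂sphereMeasure E =
      ‖u‖ ^ 2 * (sphereMeasure E).real univ := by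
  set Q : E → ℝ := fun u ↦ ∫ θ : sphere (0 : E) 1, ⟪u, (θ : E)⟫ ^ 2 ∂sphereMeasure E with hQ
  have hQ_norm {v w : E} (h : ‖v‖ = ‖w‖) : Q v = Q w := by
    let R := (ℝ ∙ (v - w))ᗮ.reflection
    have hR : R v = w := Submodule.reflection_sub h
    calc Q v = ∫ θ : sphere (0 : E) 1, ⟪w, R θ⟫ ^ 2 ∂sphereMeasure E := by
          simp only [hQ, ← hR, LinearIsometryEquiv.inner_map_map]
      _ = Q w := integral_sphere_comp_linearIsometryEquiv (⟪w, ·⟫ ^ 2) R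
  have hQ_smul (c : ℝ) (v : E) : Q (c • v) = c ^ 2 * Q v := by
    simp only [hQ, real_inner_smul_left, mul_pow, integral_const_mul]
  let b := stdOrthonormalBasis ℝ E
  have hQ_basis (i) : ‖u‖ ^ 2 * Q (b i) = Q u := by
    rw [← hQ_smul]
    exact hQ_norm (by simp [norm_smul])
  have hQ_sum : ∑ i, Q (b i) = (sphereMeasure E).real univ := by
    rw [hQ, ← integral_finsetSum _ fun i _ ↦ integrable_of_continuous_of_compactSpace
      (by fun_prop)]
    simp [b.sum_sq_inner_right]
  calc finrank ℝ E * Q u = ∑ i, ‖u‖ ^ 2 * Q (b i) := by simp [hQ_basis]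
    _ = ‖u‖ ^ 2 * (sphereMeasure E).real univ := by rw [← Finset.mul_sum, hQ_sum]

lemma finrank_mul_integral_sphere_norm_sq_le (T : E →L[ℝ] F) :
    finrank ℝ E * ∫ θ : sphere (0 : E) 1, ‖T θ‖ ^ 2 ∂sphereMeasure E ≤
      finrank ℝ F * ‖T‖ ^ 2 * (sphereMeasure E).real univ := by
  let b := stdOrthonormalBasis ℝ F
  have hadj (i) : ‖T.adjoint (b i)‖ ≤ ‖T‖ := by
    simpa using T.adjoint.le_opNorm (b i)
  calc finrank ℝ E * ∫ θ : sphere (0 : E) 1, ‖T θ‖ ^ 2 ∂sphereMeasure E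
      = finrank ℝ E * ∑ i, ∫ θ : sphere (0 : E) 1, ⟪T.adjoint (b i), (θ : E)⟫ ^ 2
          ∂sphereMeasure E := by
        rw [← integral_finsetSum _ fun i _ ↦ integrable_of_continuous_of_compactSpace
          (by fun_prop)]
        simp only [ContinuousLinearMap.adjoint_inner_left, b.sum_sq_inner_right]
    _ = ∑ i, ‖T.adjoint (b i)‖ ^ 2 * (sphereMeasure E).real univ := by
        simp only [Finset.mul_sum, finrank_mul_integral_sphere_inner_sq]
    _ ≤ ∑ _i : Fin (finrank ℝ F), ‖T‖ ^ 2 * (sphereMeasure E).real univ := by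
        gcongr with i
        exact hadj i
    _ = finrank ℝ F * ‖T‖ ^ 2 * (sphereMeasure E).real univ := by simp [mul_assoc]

end Sphere

section HyperbolicVolume

open Set Module

lemma hasDerivAt_sq_div_one_sub_sq_pow {m : ℕ} (hm : m ≠ 0) {r : ℝ} (hr : r ^ 2 ≠ 1) :
    HasDerivAt (fun r : ℝ ↦ 8 ^ m / (2 * m) * (r ^ 2 / (1 - r ^ 2)) ^ m)
      (r ^ (2 * m - 1) * (8 ^ m / (1 - r ^ 2) ^ (m + 1))) r := by
  have hr' : 1 - r ^ 2 ≠ 0 := sub_ne_zero.2 hr.symm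
  refine ((((hasDerivAt_pow 2 r).div ((hasDerivAt_pow 2 r).const_sub 1) hr').pow m).const_mul
    ((8 : ℝ) ^ m / (2 * m))).congr_deriv ?_
  obtain ⟨k, rfl⟩ := Nat.exists_eq_succ_of_ne_zero hm
  have hexp : 2 * (k + 1) - 1 = 2 * k + 1 := by omega
  have hk : (k : ℝ) + 1 ≠ 0 := by positivity
  simp only [Nat.succ_eq_add_one, hexp, Nat.add_sub_cancel, Pi.div_apply, div_pow, Nat.cast_add,
    Nat.cast_one]
  field_simp
  ring

lemma lintegral_Ioc_hyperbolic_density {m : ℕ} (hm : m ≠ 0) {ρ : ℝ} (hρ₀ : 0 ≤ ρ) (hρ₁ : ρ < 1) :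
    ∫⁻ r in Ioc 0 ρ, ENNReal.ofReal (r ^ (2 * m - 1)) *
        ENNReal.ofReal (8 ^ m / (1 - r ^ 2) ^ (m + 1)) =
      ENNReal.ofReal (8 ^ m / (2 * m) * (ρ ^ 2 / (1 - ρ ^ 2)) ^ m) := by
  have hlt (r) (hr : r ∈ Icc 0 ρ) : r ^ 2 < 1 := by nlinarith [hr.1, hr.2]
  have hint : IntervalIntegrable (fun r : ℝ ↦ r ^ (2 * m - 1) * (8 ^ m / (1 - r ^ 2) ^ (m + 1)))
      volume 0 ρ := by
    refine ContinuousOn.intervalIntegrable (.mul (by fun_prop) (.div (by fun_prop) (by fun_prop)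
      fun r hr ↦ pow_ne_zero _ (sub_pos.2 (hlt r ?_)).ne'))
    rwa [uIcc_of_le hρ₀] at hr
  have hftc := intervalIntegral.integral_eq_sub_of_hasDerivAt
    (fun r hr ↦ hasDerivAt_sq_div_one_sub_sq_pow hm (hlt r (by rwa [uIcc_of_le hρ₀] at hr)).ne) hint
  calc _ = ∫⁻ r in Ioc 0 ρ, ENNReal.ofReal (r ^ (2 * m - 1) * (8 ^ m / (1 - r ^ 2) ^ (m + 1))) :=
        setLIntegral_congr_fun measurableSet_Ioc fun r hr ↦
          (ENNReal.ofReal_mul (pow_nonneg hr.1.le _)).symm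
    _ = ENNReal.ofReal (∫ r in 0..ρ, r ^ (2 * m - 1) * (8 ^ m / (1 - r ^ 2) ^ (m + 1))) := by
        rw [intervalIntegral.integral_of_le hρ₀, ofReal_integral_eq_lintegral_ofReal
          ((intervalIntegrable_iff_integrableOn_Ioc_of_le hρ₀).1 hint)]
        filter_upwards [ae_restrict_mem measurableSet_Ioc] with r hr
        have hr₁ := sub_pos.2 (hlt r (Ioc_subset_Icc_self hr))
        have hr₀ := hr.1
        simp only [Pi.zero_apply]
        positivity
    _ = _ := by simp [hftc, hm]

variable {m : ℕ} {E : Type*} [NormedAddCommGroup E] [InnerProductSpace ℝ E]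
  [FiniteDimensional ℝ E] [MeasurableSpace E] [BorelSpace E]

lemma complexHyperbolicVolume_apply {A : Set E} (hA : MeasurableSet A) :
    complexHyperbolicVolume m E A =
      ∫⁻ x in A ∩ ball 0 1, ENNReal.ofReal (8 ^ m / (1 - ‖x‖ ^ 2) ^ (m + 1)) := by
  rw [complexHyperbolicVolume, withDensity_apply _ hA, Measure.restrict_restrict hA]

lemma complexHyperbolicVolume_eq_lintegral_sphere (hm : m ≠ 0) (hE : finrank ℝ E = 2 * m)
    {A : Set E} (hA : MeasurableSet A) {ρ : sphere (0 : E) 1 → ℝ} (hρ₀ : ∀ θ, 0 ≤ ρ θ)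
    (hρ₁ : ∀ θ, ρ θ < 1) (hray : ∀ θ : sphere (0 : E) 1, ∀ r > 0, r • (θ : E) ∈ A ↔ r ≤ ρ θ) :
    complexHyperbolicVolume m E A =
      ∫⁻ θ, ENNReal.ofReal (8 ^ m / (2 * m) * (ρ θ ^ 2 / (1 - ρ θ ^ 2)) ^ m)
        ∂sphereMeasure E := by
  have : Nontrivial E := nontrivial_of_finrank_pos (R := ℝ) (by omega)
  have hraySet (θ : sphere (0 : E) 1) :
      {r : ℝ | r • (θ : E) ∈ A ∩ ball 0 1} ∩ Ioi 0 = Ioc 0 (ρ θ) := by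
    ext r
    have hnorm (hr : 0 < r) : r • (θ : E) ∈ ball 0 1 ↔ r < 1 := by
      simp [norm_smul, abs_of_pos hr]
    have := hρ₁ θ
    have := hray θ r
    grind
  rw [complexHyperbolicVolume_apply hA, setLIntegral_eq_lintegral_toSphere _
    (hA.inter measurableSet_ball) (by fun_prop)]
  refine lintegral_congr fun θ ↦ ?_
  rw [hraySet, hE, ← lintegral_Ioc_hyperbolic_density hm (hρ₀ θ) (hρ₁ θ)]
  simp [norm_smul]

lemma complexHyperbolicVolume_lt_top {A : Set E} (hA : IsCompact A) (hA₁ : A ⊆ ball 0 1) :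
    complexHyperbolicVolume m E A < ⊤ := by
  rw [complexHyperbolicVolume_apply hA.measurableSet, inter_eq_left.2 hA₁]
  have hdensity : ContinuousOn (fun x : E ↦ (8 : ℝ) ^ m / (1 - ‖x‖ ^ 2) ^ (m + 1)) A := by
    refine .div (by fun_prop) (by fun_prop) fun x hx ↦ pow_ne_zero _ ?_
    have hx₁ : ‖x‖ < 1 := mem_ball_zero_iff.1 (hA₁ hx)
    nlinarith [norm_nonneg x]
  exact (hdensity.integrableOn_compact hA).lintegral_lt_top

lemma complexHyperbolicVolume_pos {U : Set E} (hU : IsOpen U) (hU₁ : (U ∩ ball 0 1).Nonempty) :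
    0 < complexHyperbolicVolume m E U := by
  rw [complexHyperbolicVolume_apply hU.measurableSet, setLIntegral_pos_iff (by fun_prop)]
  refine ((hU.inter isOpen_ball).measure_pos volume hU₁).trans_le
    (measure_mono fun x hx ↦ ⟨?_, hx⟩)
  have hx₁ : ‖x‖ < 1 := mem_ball_zero_iff.1 hx.2
  have hx₂ : 0 < 1 - ‖x‖ ^ 2 := by nlinarith [norm_nonneg x]
  simp only [Function.mem_support, ne_eq, ENNReal.ofReal_eq_zero, not_le]
  positivity

lemma complexHyperbolicVolume_lt_of_subset {A B : Set E} (hA : IsCompact A) (hA₁ : A ⊆ ball 0 1)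
    (hAB : A ⊆ B) (hne : ((interior B ∩ ball 0 1) \ A).Nonempty) :
    complexHyperbolicVolume m E A < complexHyperbolicVolume m E B := by
  set μ := complexHyperbolicVolume m E
  have hgap : 0 < μ (interior B \ A) := by
    refine complexHyperbolicVolume_pos (isOpen_interior.sdiff hA.isClosed) ?_
    rwa [inter_comm, ← inter_sdiff_assoc, inter_comm]
  calc μ A < μ A + μ (interior B \ A) :=
        ENNReal.lt_add_right (complexHyperbolicVolume_lt_top hA hA₁).ne hgap.ne'
    _ = μ (A ∪ interior B \ A) :=
        (measure_union disjoint_sdiff_right (isOpen_interior.sdiff hA.isClosed).measurableSet).symm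
    _ ≤ μ B := measure_mono (union_subset hAB (sdiff_subset.trans interior_subset))

end HyperbolicVolume

section PerturbedBall

open Set Filter
open scoped RealInnerProductSpace Topology

section Derivatives

variable {p P ψ : ℝ → ℝ} {s : ℝ}

lemma hasDerivAt_div {p' P' : ℝ} (hp : HasDerivAt p p' s) (hP : HasDerivAt P P' s)
    (hs : P s ≠ 0) :
    HasDerivAt (fun s ↦ p s / P s) ((p' - p s / P s * P') / P s) s :=
  (hp.div hP hs).congr_deriv (by field_simp)

lemma hasDerivAt_mul_comp_div {p' P' : ℝ} (hp : HasDerivAt p p' s) (hP : HasDerivAt P P' s)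
    (hs : P s ≠ 0) (hψ : DifferentiableAt ℝ ψ (p s / P s)) :
    HasDerivAt (fun s ↦ P s * ψ (p s / P s))
      (P' * ψ (p s / P s) + deriv ψ (p s / P s) * (p' - p s / P s * P')) s :=
  (hP.mul (hψ.hasDerivAt.comp s (hasDerivAt_div hp hP hs))).congr_deriv (by
    simp only [Function.comp_apply]
    field_simp)

lemma hasDerivAt_deriv_mul_comp_div {p' P' : ℝ → ℝ} {p'' P'' : ℝ} (hp : HasDerivAt p (p' s) s)
    (hP : HasDerivAt P (P' s) s) (hp' : HasDerivAt p' p'' s) (hP' : HasDerivAt P' P'' s)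
    (hs : P s ≠ 0) (hψ : DifferentiableAt ℝ ψ (p s / P s))
    (hψ' : DifferentiableAt ℝ (deriv ψ) (p s / P s)) :
    HasDerivAt (fun s ↦ P' s * ψ (p s / P s) + deriv ψ (p s / P s) * (p' s - p s / P s * P' s))
      (P'' * ψ (p s / P s) + deriv ψ (p s / P s) * (p'' - p s / P s * P'') +
        deriv (deriv ψ) (p s / P s) * ((p' s - p s / P s * P' s) ^ 2 / P s)) s := by
  have hτ := hasDerivAt_div hp hP hs
  refine ((hP'.mul (hψ.hasDerivAt.comp s hτ)).add ((hψ'.hasDerivAt.comp s hτ).mul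
    (hp'.sub (hτ.mul hP')))).congr_deriv ?_
  simp only [Function.comp_apply, Pi.mul_apply, Pi.sub_apply]
  field_simp
  ring

end Derivatives

lemma convexOn_univ_of_forall_line {E : Type*} [AddCommGroup E] [Module ℝ E] {f : E → ℝ}
    (hf : ∀ x y : E, ConvexOn ℝ univ fun s : ℝ ↦ f (x + s • y)) : ConvexOn ℝ univ f := by
  refine ⟨convex_univ, fun x _ y _ a b ha hb hab ↦ ?_⟩
  have hline := (hf x (y - x)).2 (mem_univ 0) (mem_univ 1) ha hb hab
  obtain rfl : a = 1 - b := by linarith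
  have hpoint : x + b • (y - x) = (1 - b) • x + b • y := by module
  simpa [hpoint] using hline

section Norm

variable {E F : Type*} [NormedAddCommGroup E] [NormedSpace ℝ E]
  [NormedAddCommGroup F] [NormedSpace ℝ F]

/-- The squared norm of `E` multiplied by a function, constant along rays, of the ratio
`‖T x‖ ^ 2 / ‖x‖ ^ 2`. -/
noncomputable def perturbedNormSq (T : E →L[ℝ] F) (φ : ℝ → ℝ) (x : E) : ℝ :=
  ‖x‖ ^ 2 * (1 + φ (‖T x‖ ^ 2 / ‖x‖ ^ 2))

/-- The star body whose squared radial function is `(1 + φ (‖T θ‖ ^ 2))⁻¹` at the unit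
vector `θ`. -/
def perturbedBall (T : E →L[ℝ] F) (φ : ℝ → ℝ) : Set E :=
  {x | perturbedNormSq T φ x ≤ 1}

variable {T : E →L[ℝ] F} {φ : ℝ → ℝ}

@[simp]
lemma perturbedNormSq_zero : perturbedNormSq T φ 0 = 0 := by simp [perturbedNormSq]

lemma perturbedNormSq_smul (c : ℝ) (x : E) :
    perturbedNormSq T φ (c • x) = c ^ 2 * perturbedNormSq T φ x := by
  rcases eq_or_ne c 0 with rfl | hc
  · simp
  · have hc' : c ^ 2 ≠ 0 := pow_ne_zero 2 hc
    simp only [perturbedNormSq, map_smul, norm_smul, mul_pow, Real.norm_eq_abs, sq_abs,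
      mul_div_mul_left _ _ hc']
    ring

lemma norm_apply_le_norm (hT : ‖T‖ ≤ 1) (x : E) : ‖T x‖ ≤ ‖x‖ := by
  simpa using T.le_of_opNorm_le hT x

lemma norm_sq_div_norm_sq_mem_Icc (hT : ‖T‖ ≤ 1) (x : E) :
    ‖T x‖ ^ 2 / ‖x‖ ^ 2 ∈ Icc (0 : ℝ) 1 :=
  ⟨by positivity, div_le_one_of_le₀ (by gcongr; exact norm_apply_le_norm hT x) (by positivity)⟩

lemma perturbedBall_subset_ball (hφ : ∀ t, 0 < φ t) : perturbedBall T φ ⊆ ball 0 1 := by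
  intro x hx
  rw [mem_ball_zero_iff]
  by_contra! h
  have hx₁ : 1 ≤ ‖x‖ ^ 2 := one_le_pow₀ h
  have hx₂ : ‖x‖ ^ 2 * (1 + φ (‖T x‖ ^ 2 / ‖x‖ ^ 2)) ≤ 1 := hx
  nlinarith [hφ (‖T x‖ ^ 2 / ‖x‖ ^ 2)]

lemma smul_mem_perturbedBall_iff (hφ : ∀ t, 0 < φ t) (θ : sphere (0 : E) 1) {r : ℝ}
    (hr : 0 < r) :
    r • (θ : E) ∈ perturbedBall T φ ↔ r ≤ √(1 + φ (‖T θ‖ ^ 2))⁻¹ := by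
  have := hφ (‖T θ‖ ^ 2)
  rw [Real.le_sqrt hr.le (by positivity), ← one_div, le_div_iff₀ (by positivity), perturbedBall,
    mem_ofPred_eq, perturbedNormSq_smul]
  simp [perturbedNormSq]

end Norm

variable {E F : Type*} [NormedAddCommGroup E] [InnerProductSpace ℝ E]
  [NormedAddCommGroup F] [InnerProductSpace ℝ F] {T : E →L[ℝ] F} {φ : ℝ → ℝ}

lemma hasDerivAt_norm_sq_line (x y : E) (s : ℝ) :
    HasDerivAt (fun s : ℝ ↦ ‖x + s • y‖ ^ 2) (2 * ⟪x + s • y, y⟫) s := by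
  simpa using (((hasDerivAt_id s).smul_const y).const_add x).norm_sq

lemma hasDerivAt_two_mul_inner_line (x y : E) (s : ℝ) :
    HasDerivAt (fun s : ℝ ↦ 2 * ⟪x + s • y, y⟫) (2 * ‖y‖ ^ 2) s := by
  simpa [real_inner_self_eq_norm_sq] using
    ((((hasDerivAt_id s).smul_const y).const_add x).inner ℝ (hasDerivAt_const s y)).const_mul 2

lemma abs_norm_sq_sub_mul_norm_sq_le (hT : ‖T‖ ≤ 1) (y : E) {τ : ℝ} (hτ : τ ∈ Icc (0 : ℝ) 1) :
    |2 * ‖T y‖ ^ 2 - τ * (2 * ‖y‖ ^ 2)| ≤ 2 * ‖y‖ ^ 2 := by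
  have hTy : ‖T y‖ ^ 2 ≤ ‖y‖ ^ 2 := by gcongr; exact norm_apply_le_norm hT y
  rw [abs_le]
  constructor <;> nlinarith [hτ.1, hτ.2, sq_nonneg ‖T y‖, sq_nonneg ‖y‖]

lemma sq_inner_sub_mul_inner_div_le (hT : ‖T‖ ≤ 1) (v y : E) {τ : ℝ} (hτ : τ ∈ Icc (0 : ℝ) 1) :
    (2 * ⟪T v, T y⟫ - τ * (2 * ⟪v, y⟫)) ^ 2 / ‖v‖ ^ 2 ≤ 16 * ‖y‖ ^ 2 := by
  have hinner : |⟪v, y⟫| ≤ ‖v‖ * ‖y‖ := abs_real_inner_le_norm v y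
  have hTinner : |⟪T v, T y⟫| ≤ ‖v‖ * ‖y‖ := (abs_real_inner_le_norm _ _).trans <| by
    gcongr <;> exact norm_apply_le_norm hT _
  refine div_le_of_le_mul₀ (by positivity) (by positivity) ?_
  calc (2 * ⟪T v, T y⟫ - τ * (2 * ⟪v, y⟫)) ^ 2
      = |2 * ⟪T v, T y⟫ - τ * (2 * ⟪v, y⟫)| ^ 2 := (sq_abs _).symm
    _ ≤ (|2 * ⟪T v, T y⟫| + |τ * (2 * ⟪v, y⟫)|) ^ 2 := by gcongr; exact abs_sub _ _
    _ = (2 * |⟪T v, T y⟫| + τ * (2 * |⟪v, y⟫|)) ^ 2 := by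
      simp only [abs_mul, abs_two, abs_of_nonneg hτ.1]
    _ ≤ (2 * (‖v‖ * ‖y‖) + 1 * (2 * (‖v‖ * ‖y‖))) ^ 2 := by
      have := hτ.1
      have := hτ.2
      gcongr
    _ = 16 * ‖y‖ ^ 2 * ‖v‖ ^ 2 := by ring

-- The expression is the second derivative of `perturbedNormSq T φ` at `v` in direction `y`,
-- with `a`, `b`, `c` the values of `φ` and of its first two derivatives at `τ`.
lemma perturbedNormSq_second_deriv_nonneg (hT : ‖T‖ ≤ 1) (v y : E) {τ a b c : ℝ}
    (hτ : τ ∈ Icc (0 : ℝ) 1) (habc : |a| + |b| + 8 * |c| ≤ 1) :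
    0 ≤ 2 * ‖y‖ ^ 2 * (1 + a) + b * (2 * ‖T y‖ ^ 2 - τ * (2 * ‖y‖ ^ 2)) +
      c * ((2 * ⟪T v, T y⟫ - τ * (2 * ⟪v, y⟫)) ^ 2 / ‖v‖ ^ 2) := by
  set B := 2 * ‖T y‖ ^ 2 - τ * (2 * ‖y‖ ^ 2)
  set C := (2 * ⟪T v, T y⟫ - τ * (2 * ⟪v, y⟫)) ^ 2 / ‖v‖ ^ 2
  have hC : 0 ≤ C := by positivity
  have hbB : |b * B| ≤ |b| * (2 * ‖y‖ ^ 2) := by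
    rw [abs_mul]
    gcongr
    exact abs_norm_sq_sub_mul_norm_sq_le hT y hτ
  have hcC : |c * C| ≤ |c| * (16 * ‖y‖ ^ 2) := by
    rw [abs_mul, abs_of_nonneg hC]
    gcongr
    exact sq_inner_sub_mul_inner_div_le hT v y hτ
  nlinarith [neg_abs_le (b * B), neg_abs_le (c * C), neg_abs_le a, sq_nonneg ‖y‖]

lemma convexOn_perturbedNormSq_line_of_ne_zero (hT : ‖T‖ ≤ 1) (hφ : ContDiff ℝ 2 φ)
    (hsmall : ∀ t ∈ Icc (0 : ℝ) 1, |φ t| + |deriv φ t| + 8 * |deriv (deriv φ) t| ≤ 1)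
    {x y : E} (hxy : ∀ s : ℝ, x + s • y ≠ 0) :
    ConvexOn ℝ univ fun s : ℝ ↦ perturbedNormSq T φ (x + s • y) := by
  have hp (s : ℝ) : HasDerivAt (fun s : ℝ ↦ ‖T (x + s • y)‖ ^ 2) (2 * ⟪T (x + s • y), T y⟫) s := by
    simpa only [map_add, map_smul] using hasDerivAt_norm_sq_line (T x) (T y) s
  have hp' (s : ℝ) : HasDerivAt (fun s : ℝ ↦ 2 * ⟪T (x + s • y), T y⟫) (2 * ‖T y‖ ^ 2) s := by
    simpa only [map_add, map_smul] using hasDerivAt_two_mul_inner_line (T x) (T y) s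
  have hP (s : ℝ) := hasDerivAt_norm_sq_line x y s
  have hs (s : ℝ) : ‖x + s • y‖ ^ 2 ≠ 0 := by simpa using hxy s
  have hψ : Differentiable ℝ fun t ↦ 1 + φ t := (hφ.differentiable two_ne_zero).const_add 1
  have hψ' : deriv (fun t ↦ 1 + φ t) = deriv φ := by ext t; simp
  have hφ' : Differentiable ℝ (deriv φ) :=
    ((contDiff_succ_iff_deriv (n := 1)).1 hφ).2.2.differentiable one_ne_zero
  have hf' (s : ℝ) := hasDerivAt_mul_comp_div (hp s) (hP s) (hs s) (hψ _)
  have hf'' (s : ℝ) := hasDerivAt_deriv_mul_comp_div (hp s) (hP s) (hp' s)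
    (hasDerivAt_two_mul_inner_line x y s) (hs s) (hψ _) (by rw [hψ']; exact hφ' _)
  refine convexOn_of_hasDerivWithinAt2_nonneg convex_univ
    (continuous_iff_continuousAt.2 fun s ↦ (hf' s).continuousAt).continuousOn
    (fun s _ ↦ (hf' s).hasDerivWithinAt) (fun s _ ↦ (hf'' s).hasDerivWithinAt) fun s _ ↦ ?_
  simp only [hψ']
  have hτ := norm_sq_div_norm_sq_mem_Icc hT (x + s • y)
  exact perturbedNormSq_second_deriv_nonneg hT _ y hτ (hsmall _ hτ)

lemma convexOn_perturbedNormSq (hT : ‖T‖ ≤ 1) (hφ : ContDiff ℝ 2 φ)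
    (hsmall : ∀ t ∈ Icc (0 : ℝ) 1, |φ t| + |deriv φ t| + 8 * |deriv (deriv φ) t| ≤ 1) :
    ConvexOn ℝ univ (perturbedNormSq T φ) := by
  refine convexOn_univ_of_forall_line fun x y ↦ ?_
  by_cases hxy : ∃ s₀ : ℝ, x + s₀ • y = 0
  · obtain ⟨s₀, hs₀⟩ := hxy
    have hline (s : ℝ) :
        perturbedNormSq T φ (x + s • y) = perturbedNormSq T φ y * (-s₀ + s) ^ 2 := by
      rw [eq_neg_of_add_eq_zero_left hs₀, mul_comm, ← perturbedNormSq_smul]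
      congr 1
      module
    have hy : 0 ≤ perturbedNormSq T φ y := by
      have := hsmall _ (norm_sq_div_norm_sq_mem_Icc hT y)
      refine mul_nonneg (sq_nonneg _) ?_
      grind [neg_abs_le (φ (‖T y‖ ^ 2 / ‖y‖ ^ 2)), abs_nonneg]
    simp only [hline]
    exact ((even_two.convexOn_pow (𝕜 := ℝ)).translate_right (-s₀)).smul hy
  · exact convexOn_perturbedNormSq_line_of_ne_zero hT hφ hsmall (not_exists.1 hxy)

lemma eventually_convexOn_perturbedNormSq (hT : ‖T‖ ≤ 1) (hφ : ContDiff ℝ 2 φ) :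
    ∀ᶠ ε in 𝓝 (0 : ℝ), ConvexOn ℝ univ (perturbedNormSq T fun t ↦ ε * φ t) := by
  have hφ' := (contDiff_succ_iff_deriv (n := 1)).1 hφ
  obtain ⟨C, hC⟩ := (isCompact_Icc (a := (0 : ℝ)) (b := 1)).exists_bound_of_continuousOn
    (f := fun t ↦ |φ t| + |deriv φ t| + 8 * |deriv (deriv φ) t|) (by
      have := hφ.continuous
      have := hφ'.2.2.continuous
      have := hφ'.2.2.continuous_deriv le_rfl
      fun_prop)
  have hlim : Tendsto (fun ε : ℝ ↦ |ε| * C) (𝓝 0) (𝓝 0) := by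
    simpa using (Continuous.tendsto (f := fun ε : ℝ ↦ |ε| * C) (by fun_prop) 0)
  filter_upwards [hlim.eventually_le_const one_pos] with ε hε
  refine convexOn_perturbedNormSq hT (contDiff_const.mul hφ) fun t ht ↦ ?_
  simp only [deriv_const_mul_field', abs_mul]
  calc _ = |ε| * (|φ t| + |deriv φ t| + 8 * |deriv (deriv φ) t|) := by ring
    _ ≤ |ε| * C := by gcongr; exact (le_abs_self _).trans (hC t ht)
    _ ≤ 1 := hε

end PerturbedBall

section Body

open Set Module
open scoped Topology

lemma complexHyperbolicVolume_perturbedBall {m : ℕ} (hm : m ≠ 0) {E F : Type*}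
    [NormedAddCommGroup E] [InnerProductSpace ℝ E] [FiniteDimensional ℝ E] [MeasurableSpace E]
    [BorelSpace E] [NormedAddCommGroup F] [NormedSpace ℝ F] (hE : finrank ℝ E = 2 * m)
    (T : E →L[ℝ] F) {w : ℝ → ℝ} (hw : Continuous w) (hw₀ : ∀ t, 0 < w t) {ε : ℝ} (hε : 0 < ε) :
    complexHyperbolicVolume m E (perturbedBall T fun t ↦ ε * (w t)⁻¹) =
      ENNReal.ofReal ((8 / ε) ^ m / (2 * m) *
        ∫ θ : sphere (0 : E) 1, w (‖T θ‖ ^ 2) ^ m ∂sphereMeasure E) := by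
  have hφ₀ (t : ℝ) : 0 < ε * (w t)⁻¹ := mul_pos hε (inv_pos.2 (hw₀ t))
  have hmeas : MeasurableSet (perturbedBall T fun t ↦ ε * (w t)⁻¹) := by
    have := hw.measurable
    exact measurableSet_le (by unfold perturbedNormSq; fun_prop) measurable_const
  have hradial (t : ℝ) : √(1 + ε * (w t)⁻¹)⁻¹ ^ 2 / (1 - √(1 + ε * (w t)⁻¹)⁻¹ ^ 2) = w t / ε := by
    have := hφ₀ t
    have := hw₀ t
    rw [Real.sq_sqrt (by positivity)]
    field_simp
    simp [hε.ne']
  have hlt (t : ℝ) : √(1 + ε * (w t)⁻¹)⁻¹ < 1 :=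
    (Real.sqrt_lt' one_pos).2 (by simpa using inv_lt_one_of_one_lt₀ (by linarith [hφ₀ t]))
  rw [complexHyperbolicVolume_eq_lintegral_sphere hm hE hmeas (fun _ ↦ Real.sqrt_nonneg _)
    (fun _ ↦ hlt _) fun θ _ hr ↦ smul_mem_perturbedBall_iff hφ₀ θ hr,
    ← integral_const_mul, ofReal_integral_eq_lintegral_ofReal
    (integrable_of_continuous_of_compactSpace (by fun_prop))
    (.of_forall fun θ ↦ by have := hw₀ (‖T θ‖ ^ 2); positivity)]
  refine lintegral_congr fun θ ↦ ?_
  rw [hradial]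
  ring_nf

variable {n : ℕ}

lemma finrank_complexHyperplane {ξ : EuclideanSpace ℂ (Fin (n + 1))} (hξ : ξ ≠ 0) :
    finrank ℝ (complexHyperplane ξ) = 2 * n := by
  have : Fact (finrank ℂ (EuclideanSpace ℂ (Fin (n + 1))) = n + 1) := ⟨by simp⟩
  calc finrank ℝ (complexHyperplane ξ) = 2 * finrank ℂ (ℂ ∙ ξ)ᗮ := finrank_real_of_complex (ℂ ∙ ξ)ᗮ
    _ = 2 * n := by rw [Submodule.finrank_orthogonal_span_singleton (n := n) hξ]

lemma exists_convexBody_eq_perturbedBall (ℓ : EuclideanSpace ℂ (Fin n) →L[ℂ] ℂ) {φ : ℝ → ℝ}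
    (hφ : ∀ t, 0 < φ t) (hconv : ConvexOn ℝ univ (perturbedNormSq (ℓ.restrictScalars ℝ) φ)) :
    ∃ K : ConvexBody (EuclideanSpace ℂ (Fin n)), IsInvariantBodyInBall K ∧
      (K : Set (EuclideanSpace ℂ (Fin n))) = perturbedBall (ℓ.restrictScalars ℝ) φ := by
  set T := ℓ.restrictScalars ℝ
  have hcont : Continuous (perturbedNormSq T φ) :=
    continuousOn_univ.1 (hconv.continuousOn isOpen_univ)
  have hball : perturbedBall T φ ⊆ ball 0 1 := perturbedBall_subset_ball hφ
  have hcompact : IsCompact (perturbedBall T φ) :=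
    isCompact_of_isClosed_isBounded (isClosed_le hcont continuous_const)
      (isBounded_ball.subset hball)
  have hconvex : Convex ℝ (perturbedBall T φ) := by
    simpa [perturbedBall] using hconv.convex_le 1
  have hrot (θ : ℝ) (x : EuclideanSpace ℂ (Fin n)) :
      Complex.exp (θ * Complex.I) • x ∈ perturbedBall T φ ↔ x ∈ perturbedBall T φ := by
    simp [perturbedBall, perturbedNormSq, T, norm_smul, Complex.norm_exp_ofReal_mul_I]
  refine ⟨⟨perturbedBall T φ, hconvex, hcompact, 0, by simp [perturbedBall]⟩,
    ⟨?_, fun θ _ x ↦ ?_, hball⟩, rfl⟩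
  · exact interior_maximal (fun x hx ↦ le_of_lt hx) (isOpen_lt hcont continuous_const)
      (show perturbedNormSq T φ 0 < 1 by simp)
  · simp only [gauge_def', smul_comm _ (Complex.exp (θ * Complex.I)) x]
    exact congrArg sInf (Set.ext fun r ↦ and_congr_right fun _ ↦ hrot θ _)

lemma eventually_exists_convexBody_eq_perturbedBall {ℓ : EuclideanSpace ℂ (Fin n) →L[ℂ] ℂ}
    (hℓ : ‖ℓ‖ ≤ 1) {w : ℝ → ℝ} (hw : ContDiff ℝ 2 w) (hw₀ : ∀ t, 0 < w t) :
    ∀ᶠ ε in 𝓝[>] (0 : ℝ), ∃ K : ConvexBody (EuclideanSpace ℂ (Fin n)), IsInvariantBodyInBall K ∧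
      (K : Set (EuclideanSpace ℂ (Fin n))) =
        perturbedBall (ℓ.restrictScalars ℝ) fun t ↦ ε * (w t)⁻¹ := by
  have hconv := eventually_convexOn_perturbedNormSq (T := ℓ.restrictScalars ℝ)
    (by simpa using hℓ) (hw.inv fun t ↦ (hw₀ t).ne')
  filter_upwards [nhdsWithin_le_nhds hconv, self_mem_nhdsWithin] with ε hε hε₀
  exact exists_convexBody_eq_perturbedBall ℓ (fun t ↦ mul_pos hε₀ (inv_pos.2 (hw₀ t))) hε

end Body

section Counterexample

open Set Module

lemma succ_mul_mul_sub_le {a b : ℝ} (ha : 0 < a) (hb : 0 ≤ b) (m : ℕ) :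
    (m + 1) * (b * (a ^ m - b ^ m)) ≤ m * (a ^ (m + 1) - b ^ (m + 1)) := by
  have hbernoulli := one_add_mul_sub_le_pow (a := b / a) (by linarith [div_nonneg hb ha.le]) (m + 1)
  have htangent : a ^ (m + 1) + (m + 1) * a ^ m * (b - a) ≤ b ^ (m + 1) := by
    calc _ = a ^ (m + 1) * (1 + (m + 1 : ℕ) * (b / a - 1)) := by push_cast; field_simp; ring
      _ ≤ a ^ (m + 1) * (b / a) ^ (m + 1) := by gcongr
      _ = b ^ (m + 1) := by rw [← mul_pow, mul_div_cancel₀ _ ha.ne']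
  linear_combination htangent

lemma integral_pow_succ_lt {X : Type*} [MeasurableSpace X] {μ : Measure X} {m : ℕ} {a b : X → ℝ}
    (ha : ∀ x, 0 < a x) (hb : ∀ x, 0 ≤ b x) (hai : Integrable (fun x ↦ a x ^ (m + 1)) μ)
    (hbi : Integrable (fun x ↦ b x ^ (m + 1)) μ)
    (habi : Integrable (fun x ↦ b x * (a x ^ m - b x ^ m)) μ)
    (hpos : 0 < ∫ x, b x * (a x ^ m - b x ^ m) ∂μ) :
    ∫ x, b x ^ (m + 1) ∂μ < ∫ x, a x ^ (m + 1) ∂μ := by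
  have hint := integral_mono (habi.const_mul (m + 1 : ℝ)) ((hai.sub hbi).const_mul (m : ℝ))
    fun x ↦ succ_mul_mul_sub_le (ha x) (hb x) m
  simp only [Pi.sub_apply, integral_const_mul, integral_sub hai hbi] at hint
  have hlt : 0 < (m : ℝ) * (∫ x, a x ^ (m + 1) ∂μ - ∫ x, b x ^ (m + 1) ∂μ) :=
    hint.trans_lt' (by positivity)
  exact sub_pos.1 (pos_of_mul_pos_right hlt m.cast_nonneg)

lemma exists_contDiff_le_integral_comp_mul_pos {X : Type*} [TopologicalSpace X] [CompactSpace X]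
    [MeasurableSpace X] [OpensMeasurableSpace X] {μ : Measure X} [IsFiniteMeasureOnCompacts μ]
    [μ.IsOpenPosMeasure] {k : ℕ∞} {f : ℝ → ℝ} (hf : ContDiff ℝ k f) {y : X → ℝ}
    (hy : Continuous y) {x₀ : X} (hx₀ : 0 < y x₀) :
    ∃ g : ℝ → ℝ, ContDiff ℝ k g ∧ f ≤ g ∧ 0 < ∫ x, g (y x) * y x ∂μ := by
  have hf' : Continuous f := hf.continuous
  have hglue : Continuous expNegInvGlue := (expNegInvGlue.contDiff (n := 0)).continuous
  set I := ∫ x, f (y x) * y x ∂μ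
  set J := ∫ x, expNegInvGlue (y x) * y x ∂μ
  have hJ : 0 < J := by
    refine Continuous.integral_pos_of_hasCompactSupport_nonneg_nonzero (x := x₀)
      (by fun_prop) (.of_compactSpace _) (fun x ↦ ?_)
      (mul_pos (expNegInvGlue.pos_of_pos hx₀) hx₀).ne'
    rcases le_total (y x) 0 with hx | hx
    · simp [expNegInvGlue.zero_of_nonpos hx]
    · exact mul_nonneg (expNegInvGlue.nonneg _) hx
  have hA : 0 ≤ (|I| + 1) / J := by positivity
  refine ⟨fun t ↦ f t + (|I| + 1) / J * expNegInvGlue t,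
    hf.add (contDiff_const.mul expNegInvGlue.contDiff),
    fun t ↦ le_add_of_nonneg_right (mul_nonneg hA (expNegInvGlue.nonneg t)), ?_⟩
  have hsum : ∫ x, (f (y x) + (|I| + 1) / J * expNegInvGlue (y x)) * y x ∂μ =
      I + (|I| + 1) / J * J := by
    simp only [add_mul, mul_assoc]
    rw [integral_add (integrable_of_continuous_of_compactSpace (by fun_prop))
      (integrable_of_continuous_of_compactSpace (by fun_prop)), integral_const_mul]
  rw [hsum, div_mul_cancel₀ _ hJ.ne']
  linarith [neg_abs_le I]

lemma exists_contDiff_pow_eq {k : WithTop ℕ∞} {f : ℝ → ℝ} (hf : ContDiff ℝ k f)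
    (hf₀ : ∀ t, 0 < f t) {m : ℕ} (hm : m ≠ 0) :
    ∃ w : ℝ → ℝ, ContDiff ℝ k w ∧ (∀ t, 0 < w t) ∧ ∀ t, w t ^ m = f t :=
  ⟨fun t ↦ f t ^ (m : ℝ)⁻¹, hf.rpow_const_of_ne fun t ↦ (hf₀ t).ne',
    fun t ↦ Real.rpow_pos_of_pos (hf₀ t) _, fun t ↦ Real.rpow_inv_natCast_pow (hf₀ t).le hm⟩

lemma integral_sphere_mul_norm_sq_sub_one_nonpos {m : ℕ} {E : Type*} [NormedAddCommGroup E]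
    [InnerProductSpace ℝ E] [FiniteDimensional ℝ E] [MeasurableSpace E] [BorelSpace E]
    (hE : finrank ℝ E = 2 * m) {T : E →L[ℝ] ℂ} (hT : ‖T‖ ≤ 1) :
    ∫ θ : sphere (0 : E) 1, (m * ‖T θ‖ ^ 2 - 1) ∂sphereMeasure E ≤ 0 := by
  have hmean := finrank_mul_integral_sphere_norm_sq_le T
  rw [hE, Complex.finrank_real_complex] at hmean
  push_cast at hmean
  have hT₂ : ‖T‖ ^ 2 * (sphereMeasure E).real univ ≤ (sphereMeasure E).real univ :=
    mul_le_of_le_one_left measureReal_nonneg (pow_le_one₀ (norm_nonneg _) hT)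
  rw [integral_sub (integrable_of_continuous_of_compactSpace (by fun_prop)) (integrable_const 1),
    integral_const_mul, integral_const, smul_eq_mul, mul_one]
  linarith

section Volumes

variable {m : ℕ} {E : Type*} [NormedAddCommGroup E] [InnerProductSpace ℝ E]
  [FiniteDimensional ℝ E] [MeasurableSpace E] [BorelSpace E]
  {T : E →L[ℝ] ℂ} {w₁ w₂ : ℝ → ℝ} {ε : ℝ}

lemma complexHyperbolicVolume_perturbedBall_le (hm : m ≠ 0) (hE : finrank ℝ E = 2 * m)
    (hT : ‖T‖ ≤ 1) (hw₁ : Continuous w₁) (hw₂ : Continuous w₂) (hw₁₀ : ∀ t, 0 < w₁ t)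
    (hw₂₀ : ∀ t, 0 < w₂ t) (hpow : ∀ t, w₁ t ^ m = w₂ t ^ m + (m * t - 1)) (hε : 0 < ε) :
    complexHyperbolicVolume m E (perturbedBall T fun t ↦ ε * (w₁ t)⁻¹) ≤
      complexHyperbolicVolume m E (perturbedBall T fun t ↦ ε * (w₂ t)⁻¹) := by
  have hint : ∫ θ : sphere (0 : E) 1, w₁ (‖T θ‖ ^ 2) ^ m ∂sphereMeasure E ≤
      ∫ θ : sphere (0 : E) 1, w₂ (‖T θ‖ ^ 2) ^ m ∂sphereMeasure E := by
    simp only [hpow]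
    rw [integral_add (integrable_of_continuous_of_compactSpace (by fun_prop))
      (integrable_of_continuous_of_compactSpace (by fun_prop))]
    linarith [integral_sphere_mul_norm_sq_sub_one_nonpos hE hT]
  rw [complexHyperbolicVolume_perturbedBall hm hE T hw₁ hw₁₀ hε,
    complexHyperbolicVolume_perturbedBall hm hE T hw₂ hw₂₀ hε]
  exact ENNReal.ofReal_le_ofReal (mul_le_mul_of_nonneg_left hint (by positivity))

lemma complexHyperbolicVolume_perturbedBall_lt (hE : finrank ℝ E = 2 * (m + 1))
    (hw₁ : Continuous w₁) (hw₂ : Continuous w₂) (hw₁₀ : ∀ t, 0 < w₁ t) (hw₂₀ : ∀ t, 0 < w₂ t)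
    (hpow : ∀ t, w₁ t ^ m = w₂ t ^ m + (m * t - 1)) (hε : 0 < ε)
    (hpos : 0 < ∫ θ : sphere (0 : E) 1, w₂ (‖T θ‖ ^ 2) * (m * ‖T θ‖ ^ 2 - 1) ∂sphereMeasure E) :
    complexHyperbolicVolume (m + 1) E (perturbedBall T fun t ↦ ε * (w₂ t)⁻¹) <
      complexHyperbolicVolume (m + 1) E (perturbedBall T fun t ↦ ε * (w₁ t)⁻¹) := by
  have hlt := integral_pow_succ_lt (X := sphere (0 : E) 1) (μ := sphereMeasure E) (m := m)
    (a := fun θ ↦ w₁ (‖T θ‖ ^ 2)) (b := fun θ ↦ w₂ (‖T θ‖ ^ 2))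
    (fun _ ↦ hw₁₀ _) (fun _ ↦ (hw₂₀ _).le)
    (integrable_of_continuous_of_compactSpace (by fun_prop))
    (integrable_of_continuous_of_compactSpace (by fun_prop))
    (integrable_of_continuous_of_compactSpace (by fun_prop)) (by simpa [hpow] using hpos)
  have hnonneg : 0 ≤ ∫ θ : sphere (0 : E) 1, w₂ (‖T θ‖ ^ 2) ^ (m + 1) ∂sphereMeasure E :=
    integral_nonneg fun θ ↦ pow_nonneg (hw₂₀ _).le _
  rw [complexHyperbolicVolume_perturbedBall m.succ_ne_zero hE T hw₁ hw₁₀ hε,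
    complexHyperbolicVolume_perturbedBall m.succ_ne_zero hE T hw₂ hw₂₀ hε,
    ENNReal.ofReal_lt_ofReal_iff_of_nonneg (by positivity)]
  gcongr

end Volumes

lemma sectionHVol_perturbedBall {n : ℕ} {F : Type*} [NormedAddCommGroup F] [NormedSpace ℝ F]
    (T : EuclideanSpace ℂ (Fin (n + 1)) →L[ℝ] F) (φ : ℝ → ℝ)
    (ξ : EuclideanSpace ℂ (Fin (n + 1))) :
    sectionHVol (perturbedBall T φ) ξ = complexHyperbolicVolume n (complexHyperplane ξ)
      (perturbedBall (T ∘L (complexHyperplane ξ).subtypeL) φ) :=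
  rfl

lemma exists_contDiff_weights {m : ℕ} (hm : 2 ≤ m) {E F : Type*} [NormedAddCommGroup E]
    [InnerProductSpace ℝ E] [FiniteDimensional ℝ E] [MeasurableSpace E] [BorelSpace E]
    [NormedAddCommGroup F] [NormedSpace ℝ F] {T : E →L[ℝ] F} {θ₀ : E} (hθ₀ : ‖θ₀‖ = 1)
    (hTθ₀ : ‖T θ₀‖ = 1) :
    ∃ w₁ w₂ : ℝ → ℝ, ContDiff ℝ 2 w₁ ∧ ContDiff ℝ 2 w₂ ∧ (∀ t, 0 < w₁ t) ∧ (∀ t, 0 < w₂ t) ∧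
      (∀ t, w₁ t ^ m = w₂ t ^ m + (m * t - 1)) ∧
      0 < ∫ θ : sphere (0 : E) 1, w₂ (‖T θ‖ ^ 2) * (m * ‖T θ‖ ^ 2 - 1) ∂sphereMeasure E := by
  have hm₀ : m ≠ 0 := by omega
  have hm₁ : (1 : ℝ) < m := by exact_mod_cast hm
  obtain ⟨g, hg, hfg, hpos⟩ := exists_contDiff_le_integral_comp_mul_pos
    (μ := sphereMeasure E) (k := 2) (f := fun t ↦ 1 + t ^ 2) (by fun_prop)
    (y := fun θ ↦ m * ‖T θ‖ ^ 2 - 1) (by fun_prop) (x₀ := ⟨θ₀, by simpa using hθ₀⟩)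
    (by simpa [hTθ₀] using hm₁)
  replace hfg (t : ℝ) : 1 + t ^ 2 ≤ g t := hfg t
  have hgm (t : ℝ) : 0 < g t ^ m + t := by
    have hg₁ : 1 ≤ g t := (le_add_of_nonneg_right (sq_nonneg t)).trans (hfg t)
    nlinarith [hfg t, le_self_pow₀ hg₁ hm₀]
  obtain ⟨w, hw, hw₀, hwm⟩ := exists_contDiff_pow_eq ((hg.pow m).add contDiff_id) hgm hm₀
  have haffine : ContDiff ℝ 2 fun t : ℝ ↦ m * t - 1 := by fun_prop
  exact ⟨fun t ↦ w (m * t - 1), fun t ↦ g (m * t - 1), hw.comp haffine, hg.comp haffine,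
    fun t ↦ hw₀ _, fun t ↦ (hfg _).trans_lt' (by positivity), fun t ↦ hwm _, hpos⟩

lemma exists_sectionHVol_le_and_hVol_lt {n : ℕ} (hn : 3 ≤ n) :
    ∃ K L : ConvexBody (EuclideanSpace ℂ (Fin n)),
      IsInvariantBodyInBall K ∧ IsInvariantBodyInBall L ∧
      (∀ ξ : EuclideanSpace ℂ (Fin n), ‖ξ‖ = 1 →
        sectionHVol (K : Set (EuclideanSpace ℂ (Fin n))) ξ ≤
          sectionHVol (L : Set (EuclideanSpace ℂ (Fin n))) ξ) ∧
      HVol (L : Set (EuclideanSpace ℂ (Fin n))) < HVol (K : Set (EuclideanSpace ℂ (Fin n))) := by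
  obtain ⟨m, rfl⟩ : ∃ m, n = m + 1 := ⟨n - 1, by omega⟩
  let ℓ : EuclideanSpace ℂ (Fin (m + 1)) →L[ℂ] ℂ := EuclideanSpace.proj 0
  let T := ℓ.restrictScalars ℝ
  have hℓ : ‖ℓ‖ ≤ 1 := ℓ.opNorm_le_bound zero_le_one fun x ↦ by
    simpa [ℓ] using PiLp.norm_apply_le x 0
  have hTξ (ξ : EuclideanSpace ℂ (Fin (m + 1))) : ‖T ∘L (complexHyperplane ξ).subtypeL‖ ≤ 1 :=
    ContinuousLinearMap.opNorm_le_bound _ zero_le_one fun x ↦ by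
      simpa [T] using norm_apply_le_norm (T := T) (by simpa [T] using hℓ) (x : EuclideanSpace ℂ _)
  obtain ⟨w₁, w₂, hw₁, hw₂, hw₁₀, hw₂₀, hpow, hpos⟩ := exists_contDiff_weights (m := m) (by omega)
    (T := T) (θ₀ := EuclideanSpace.single 0 1) (by simp) (by simp [T, ℓ])
  obtain ⟨ε, ⟨K, hK, hKeq⟩, ⟨L, hL, hLeq⟩, hε⟩ :=
    ((eventually_exists_convexBody_eq_perturbedBall hℓ hw₁ hw₁₀).and
      ((eventually_exists_convexBody_eq_perturbedBall hℓ hw₂ hw₂₀).and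
        self_mem_nhdsWithin)).exists
  refine ⟨K, L, hK, hL, fun ξ hξ ↦ ?_, ?_⟩
  · have hξ₀ : ξ ≠ 0 := norm_ne_zero_iff.1 (hξ ▸ one_ne_zero)
    rw [hKeq, hLeq, sectionHVol_perturbedBall, sectionHVol_perturbedBall]
    exact complexHyperbolicVolume_perturbedBall_le (by omega) (finrank_complexHyperplane hξ₀)
      (hTξ ξ) hw₁.continuous hw₂.continuous hw₁₀ hw₂₀ hpow hε
  · rw [hKeq, hLeq]
    exact complexHyperbolicVolume_perturbedBall_lt (by simp [finrank_real_of_complex])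
      hw₁.continuous hw₂.continuous hw₁₀ hw₂₀ hpow hε hpos

end Counterexample

section DimensionTwo

open Set Module

lemma exists_mem_Icc_eq_norm_mul_exp (c : ℂ) :
    ∃ θ ∈ Icc 0 (2 * Real.pi), c = ‖c‖ * Complex.exp (θ * Complex.I) := by
  rcases le_or_gt 0 c.arg with harg | harg
  · exact ⟨c.arg, ⟨harg, by linarith [c.arg_le_pi, Real.pi_pos]⟩, c.norm_mul_exp_arg_mul_I.symm⟩
  · refine ⟨c.arg + 2 * Real.pi, ⟨by linarith [c.neg_pi_lt_arg, Real.pi_pos], by linarith⟩, ?_⟩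
    push_cast
    rw [add_mul, Complex.exp_add, Complex.exp_two_pi_mul_I, mul_one, c.norm_mul_exp_arg_mul_I]

namespace IsInvariantBodyInBall

variable {n : ℕ} {K : ConvexBody (EuclideanSpace ℂ (Fin n))}

lemma smul_mem (hK : IsInvariantBodyInBall K) {c : ℂ} (hc : ‖c‖ ≤ 1)
    {x : EuclideanSpace ℂ (Fin n)} (hx : x ∈ (K : Set (EuclideanSpace ℂ (Fin n)))) :
    c • x ∈ (K : Set (EuclideanSpace ℂ (Fin n))) := by
  have hzero : (K : Set (EuclideanSpace ℂ (Fin n))) ∈ nhds 0 :=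
    mem_interior_iff_mem_nhds.1 hK.zero_mem_interior
  have hgauge (z) : gauge (K : Set (EuclideanSpace ℂ (Fin n))) z ≤ 1 ↔
      z ∈ (K : Set (EuclideanSpace ℂ (Fin n))) := by
    rw [gauge_le_one_iff_mem_closure K.convex hzero, K.isCompact.isClosed.closure_eq]
  obtain ⟨θ, hθ, hcθ⟩ := exists_mem_Icc_eq_norm_mul_exp c
  have hrot : Complex.exp (θ * Complex.I) • x ∈ (K : Set (EuclideanSpace ℂ (Fin n))) := by
    rwa [← hgauge, hK.rotation_invariant θ hθ, hgauge]
  rw [hcθ, mul_smul, Complex.coe_smul]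
  exact K.convex.smul_mem_of_zero_mem (mem_of_mem_nhds hzero) hrot ⟨norm_nonneg c, hc⟩

end IsInvariantBodyInBall

lemma exists_norm_eq_one_mem_complexHyperplane {n : ℕ} (hn : 2 ≤ n)
    (x : EuclideanSpace ℂ (Fin n)) :
    ∃ ξ : EuclideanSpace ℂ (Fin n), ‖ξ‖ = 1 ∧ x ∈ complexHyperplane ξ := by
  have : Nontrivial (ℂ ∙ x)ᗮ := by
    rw [Submodule.nontrivial_iff_ne_bot, ne_eq, Submodule.orthogonal_eq_bot_iff]
    intro htop
    have hspan : finrank ℂ (ℂ ∙ x) ≤ 1 :=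
      (finrank_span_le_card ({x} : Set (EuclideanSpace ℂ (Fin n)))).trans (by simp)
    rw [htop, finrank_top, finrank_euclideanSpace_fin] at hspan
    omega
  obtain ⟨ξ, hξ⟩ := exists_norm_eq (ℂ ∙ x)ᗮ zero_le_one
  exact ⟨ξ, by simpa using hξ, Submodule.mem_orthogonal_singleton_iff_inner_left.2
    (Submodule.mem_orthogonal_singleton_iff_inner_right.1 ξ.2)⟩

variable {K L : ConvexBody (EuclideanSpace ℂ (Fin 2))}

lemma mem_of_norm_le_of_mem_complexHyperplane (hK : IsInvariantBodyInBall K)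
    {ξ x y : EuclideanSpace ℂ (Fin 2)} (hξ : ξ ≠ 0) (hx : x ∈ complexHyperplane ξ)
    (hy : y ∈ complexHyperplane ξ) (hxK : x ∈ (K : Set (EuclideanSpace ℂ (Fin 2))))
    (hyx : ‖y‖ ≤ ‖x‖) : y ∈ (K : Set (EuclideanSpace ℂ (Fin 2))) := by
  rcases eq_or_ne x 0 with rfl | hx₀
  · rwa [norm_le_zero_iff.1 (hyx.trans_eq norm_zero)]
  have : Fact (finrank ℂ (EuclideanSpace ℂ (Fin 2)) = 1 + 1) := ⟨by simp⟩
  have hline : finrank ℂ (ℂ ∙ ξ)ᗮ = 1 := Submodule.finrank_orthogonal_span_singleton hξ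
  obtain ⟨c, hc⟩ := exists_smul_eq_of_finrank_eq_one hline (x := ⟨x, hx⟩)
    (fun h ↦ hx₀ (congrArg Subtype.val h)) ⟨y, hy⟩
  obtain rfl : c • x = y := congrArg Subtype.val hc
  refine hK.smul_mem (le_of_mul_le_mul_right ?_ (norm_pos_iff.2 hx₀)) hxK
  rwa [← norm_smul, one_mul]

lemma subset_of_sectionHVol_le (hK : IsInvariantBodyInBall K) (hL : IsInvariantBodyInBall L)
    (hKL : ∀ ξ : EuclideanSpace ℂ (Fin 2), ‖ξ‖ = 1 →
      sectionHVol (K : Set (EuclideanSpace ℂ (Fin 2))) ξ ≤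
        sectionHVol (L : Set (EuclideanSpace ℂ (Fin 2))) ξ) :
    (K : Set (EuclideanSpace ℂ (Fin 2))) ⊆ L := by
  intro x hxK
  by_contra hxL
  obtain ⟨ξ, hξ, hxξ⟩ := exists_norm_eq_one_mem_complexHyperplane le_rfl x
  have hξ₀ : ξ ≠ 0 := norm_ne_zero_iff.1 (hξ ▸ one_ne_zero)
  have hx₀ : ‖x‖ ≠ 0 := norm_ne_zero_iff.2 fun h ↦
    hxL (h ▸ interior_subset hL.zero_mem_interior)
  let sect (M : ConvexBody (EuclideanSpace ℂ (Fin 2))) : Set (complexHyperplane ξ) :=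
    {y | (y : EuclideanSpace ℂ (Fin 2)) ∈ (M : Set (EuclideanSpace ℂ (Fin 2)))}
  have hclosed : IsClosed (sect L) := L.isCompact.isClosed.preimage continuous_subtype_val
  have hball : sect L ⊆ ball 0 1 := fun y hy ↦ by simpa using hL.subset_ball hy
  have hKx {y : complexHyperplane ξ} (hy : ‖y‖ ≤ ‖x‖) : y ∈ sect K :=
    mem_of_norm_le_of_mem_complexHyperplane hK hξ₀ hxξ y.2 hxK hy
  have hLx {y : complexHyperplane ξ} (hy : y ∈ sect L) : ‖y‖ ≤ ‖x‖ :=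
    le_of_not_ge fun hle ↦ hxL (mem_of_norm_le_of_mem_complexHyperplane hL hξ₀ y.2 hxξ hy hle)
  refine (hKL ξ hξ).not_gt (complexHyperbolicVolume_lt_of_subset
    (isCompact_of_isClosed_isBounded hclosed (isBounded_ball.subset hball)) hball
    (fun y hy ↦ hKx (hLx hy)) ?_)
  have hgap : (ball (0 : complexHyperplane ξ) ‖x‖ \ sect L).Nonempty := by
    refine sdiff_nonempty.2 fun hsub ↦ hxL ?_
    have hclosure := closure_minimal hsub hclosed
    rw [closure_ball _ hx₀] at hclosure
    exact hclosure (a := ⟨x, hxξ⟩) (by simp)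
  refine hgap.mono (sdiff_subset_sdiff_left (subset_inter ?_ (ball_subset_ball ?_)))
  · exact interior_maximal (fun y hy ↦ hKx (mem_ball_zero_iff.1 hy).le) isOpen_ball
  · simpa using (mem_ball_zero_iff.1 (hK.subset_ball hxK)).le

end DimensionTwo

theorem theorem4 (n : ℕ) (hn : 2 ≤ n) :
    (n ≤ 2 →
      ∀ K L : ConvexBody (EuclideanSpace ℂ (Fin n)),
        IsInvariantBodyInBall K → IsInvariantBodyInBall L →
        (∀ ξ : EuclideanSpace ℂ (Fin n), ‖ξ‖ = 1 →
          sectionHVol (K : Set (EuclideanSpace ℂ (Fin n))) ξ ≤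
            sectionHVol (L : Set (EuclideanSpace ℂ (Fin n))) ξ) →
        HVol (K : Set (EuclideanSpace ℂ (Fin n))) ≤
          HVol (L : Set (EuclideanSpace ℂ (Fin n)))) ∧
    (3 ≤ n →
      ∃ K L : ConvexBody (EuclideanSpace ℂ (Fin n)),
        IsInvariantBodyInBall K ∧ IsInvariantBodyInBall L ∧
        (∀ ξ : EuclideanSpace ℂ (Fin n), ‖ξ‖ = 1 →
          sectionHVol (K : Set (EuclideanSpace ℂ (Fin n))) ξ ≤
            sectionHVol (L : Set (EuclideanSpace ℂ (Fin n))) ξ) ∧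
        HVol (L : Set (EuclideanSpace ℂ (Fin n))) <
          HVol (K : Set (EuclideanSpace ℂ (Fin n)))) := by
  refine ⟨fun h2 K L hK hL hKL ↦ ?_, exists_sectionHVol_le_and_hVol_lt⟩
  obtain rfl : n = 2 := le_antisymm h2 hn
  exact measure_mono (subset_of_sectionHVol_le hK hL hKL)
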